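/- All graphs are finite and simple. Let $\mathcal G$ be the rectangular grid with point set $\mathbb Z^2$, in which two points are joined by a grid edge when they agree in one coordinate and differ by $1$ in the other. A grid path is a path in $\mathcal G$ with at least one grid edge; a bend of it is an interior point at which it turns. For $k\ge 0$, a $B_k$-EPG representation of a graph $G$ is a family $(P_v)_{v\in V(G)}$ of grid paths, each with at most $k$ bends, such that any two distinct vertices $u,v$ are adjacent in $G$ if and only if $P_u$ and $P_v$ share at least one grid edge. A graph that has such a representation is called $B_k$-EPG. A cut vertex of a connected graph $G$ is a vertex $v$ such that $G-v$ is disconnected. A block of a graph is a maximal biconnected subgraph, where a graph is biconnected if it is connected, has at least two vertices and has no cut vertex. A cactus graph is a connected graph in which every block is a single edge or a cycle. Theorem. Every cactus graph $G$ is $B_1$-EPG. Moreover, for every cut vertex $r$ of $G$ there is a $B_1$-EPG representation $(P_v)_{v\in V(G)}$ of $G$ in which $P_r$ is a vertical path with no bends. -/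

import Mathlib

/-! ### Edge intersection graphs of paths on a grid -/

/-- The rectangular grid: the points of `ℤ × ℤ`, two of them being joined by a grid edge if and
only if they agree in one coordinate and differ by one in the other. -/
def rectGrid : SimpleGraph (ℤ × ℤ) where
  Adj p q := (p.1 = q.1 ∧ |p.2 - q.2| = 1) ∨ (p.2 = q.2 ∧ |p.1 - q.1| = 1)
  symm := ⟨fun p q h => by rw [eq_comm, abs_sub_comm, @eq_comm _ q.2, abs_sub_comm q.1]; exact h⟩
  loopless := ⟨fun p h => by simp at h⟩

/-- A nontrivial path on the grid: a walk along grid edges that repeats no grid point and uses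
at least one grid edge. -/
structure GridPath where
  source : ℤ × ℤ
  target : ℤ × ℤ
  walk : rectGrid.Walk source target
  isPath : walk.IsPath
  nontrivial : 0 < walk.length

namespace GridPath

/-- The set of grid edges that a grid path uses. -/
def edgeSet (P : GridPath) : Set (Sym2 (ℤ × ℤ)) :=
  {e | e ∈ P.walk.edges}

/-- The number of bends of a grid path: the number of its interior points at which it turns,
that is, whose predecessor and successor on the path differ in both coordinates. -/
def bends (P : GridPath) : ℕ :=
  ((Finset.Ioo 0 P.walk.length).filter fun i =>
    (P.walk.getVert (i - 1)).1 ≠ (P.walk.getVert (i + 1)).1 ∧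
    (P.walk.getVert (i - 1)).2 ≠ (P.walk.getVert (i + 1)).2).card

/-- All points of the grid path lie on one vertical grid line. -/
def IsVertical (P : GridPath) : Prop :=
  ∀ p ∈ P.walk.support, p.1 = P.source.1

end GridPath

/-- The edge intersection graph `EPG(𝒫)` of a family of grid paths: distinct members of the family
are adjacent if and only if their paths share at least one grid edge. -/
def epgGraph {ι : Type*} (P : ι → GridPath) : SimpleGraph ι where
  Adj u v := u ≠ v ∧ ((P u).edgeSet ∩ (P v).edgeSet).Nonempty
  symm := ⟨fun _ _ h => ⟨h.1.symm, by rw [Set.inter_comm]; exact h.2⟩⟩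
  loopless := ⟨fun _ h => h.1 rfl⟩

/-- The family `P`, with one grid path for each vertex of `G`, is a `B_k`-EPG representation
of `G`: its edge intersection graph is `G`, and each path has at most `k` bends. -/
def IsBEPGRepresentation {V : Type*} (k : ℕ) (G : SimpleGraph V) (P : V → GridPath) : Prop :=
  epgGraph P = G ∧ ∀ v, (P v).bends ≤ k

/-- `G` is `B_k`-EPG if it has a `B_k`-EPG representation. -/
def IsBEPG {V : Type*} (k : ℕ) (G : SimpleGraph V) : Prop :=
  ∃ P : V → GridPath, IsBEPGRepresentation k G P

/-! ### Blocks and cactus graphs -/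

/-- The vertex `v` of the connected graph `G` is a cut vertex: `G - v` is disconnected.
(The graph without vertices does not count as disconnected.) -/
def IsCutVertex {V : Type*} (G : SimpleGraph V) (v : V) : Prop :=
  ¬ (G.induce {v}ᶜ).Preconnected

/-- A biconnected graph: a connected graph with at least two vertices and no cut vertex. A single
edge is biconnected. -/
def IsBiconnected {V : Type*} (G : SimpleGraph V) : Prop :=
  Nontrivial V ∧ G.Connected ∧ ∀ v, ¬ IsCutVertex G v

/-- A block of `G` is a maximal biconnected subgraph of `G`. -/
def IsBlock {V : Type*} {G : SimpleGraph V} (B : G.Subgraph) : Prop :=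
  Maximal (fun H : G.Subgraph => IsBiconnected H.coe) B

/-- A cactus graph is a connected graph in which every block is either a single edge or a cycle. -/
def IsCactus {V : Type*} (G : SimpleGraph V) : Prop :=
  G.Connected ∧ ∀ B : G.Subgraph, IsBlock B →
    (∃ (u v : V) (h : G.Adj u v), B = G.subgraphOfAdj h) ∨
    (∃ (u : V) (c : G.Walk u u), c.IsCycle ∧ B = c.toSubgraph)

/-! A cactus is built from a single vertex `r`, which may be chosen freely, by repeatedly attaching
at an old vertex `v` either a pendant edge or a cycle. Each path is an L-shape, and the induction
carries one extra invariant: every shape owns a unit edge used by no other shape.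

To attach new vertices at `v`, exchange the coordinates if necessary so that the private edge of `v`
is vertical, and stretch the grid around it. This opens an empty box crossed only by the segment of
`v`. A gadget placed there represents the path of new vertices; exactly the ends of that path
overlap the segment, and every new shape has a private edge. The lowest unit edge of the segment
stays below the gadget and remains private to `v`. Stretching and exchanging coordinates keep the
shape of `r` straight; a final exchange makes it vertical. This is `IsLRepresentation.extend`.

The building sequence is found by peeling off leaf blocks. An inclusion-minimal set `C` that avoids
`r` and is separated from the rest by one vertex `v` forms, together with `v`, a block
(`IsBranch.isBlock`), hence an edge or a cycle. What is left after removing `C` satisfies the same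
closure conditions (`IsBranch.isBlockClosed_diff`). -/

/-! ### L-shapes and coordinatewise maps. -/

/-- An L-shaped lattice path with corner `(a, b)`, consisting of a horizontal segment from
`(a', b)` to `(a, b)` and a vertical segment from `(a, b)` to `(a, b')`. -/
structure LShape where
  a : ℤ
  a' : ℤ
  b : ℤ
  b' : ℤ

namespace LShape

/-- The shape uses the horizontal unit edge from `(x, y)` to `(x + 1, y)`. -/
def HMem (P : LShape) (x y : ℤ) : Prop :=
  y = P.b ∧ min P.a P.a' ≤ x ∧ x < max P.a P.a'

/-- The shape uses the vertical unit edge from `(x, y)` to `(x, y + 1)`. -/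
def VMem (P : LShape) (x y : ℤ) : Prop :=
  x = P.a ∧ min P.b P.b' ≤ y ∧ y < max P.b P.b'

/-- Two shapes have a unit edge in common. -/
def Share (P Q : LShape) : Prop :=
  (∃ x y, P.HMem x y ∧ Q.HMem x y) ∨ ∃ x y, P.VMem x y ∧ Q.VMem x y

/-- The shape has no turn. -/
def IsStraight (P : LShape) : Prop :=
  P.a = P.a' ∨ P.b = P.b'

/-- The image of a shape under a map acting on each coordinate. -/
def map (f g : ℤ → ℤ) (P : LShape) : LShape :=
  ⟨f P.a, f P.a', g P.b, g P.b'⟩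

/-- Exchange of the two coordinates. -/
def swap (P : LShape) : LShape :=
  ⟨P.b, P.b', P.a, P.a'⟩

theorem share_iff (P Q : LShape) : P.Share Q ↔
    (P.b = Q.b ∧ max (min P.a P.a') (min Q.a Q.a') < min (max P.a P.a') (max Q.a Q.a')) ∨
    (P.a = Q.a ∧ max (min P.b P.b') (min Q.b Q.b') < min (max P.b P.b') (max Q.b Q.b')) := by
  constructor
  · rintro (⟨x, y, h1, h2⟩ | ⟨x, y, h1, h2⟩) <;> simp only [HMem, VMem] at h1 h2 <;> omega
  · rintro (h | h)
    · exact Or.inl ⟨max (min P.a P.a') (min Q.a Q.a'), P.b, by unfold HMem; omega,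
        by unfold HMem; omega⟩
    · exact Or.inr ⟨P.a, max (min P.b P.b') (min Q.b Q.b'), by unfold VMem; omega,
        by unfold VMem; omega⟩

theorem share_comm (P Q : LShape) : P.Share Q ↔ Q.Share P := by
  simp only [share_iff]; omega

theorem hMem_map {f g : ℤ → ℤ} (hf : StrictMono f) (hg : StrictMono g) (P : LShape) (x y : ℤ) :
    (P.map f g).HMem (f x) (g y) ↔ P.HMem x y := by
  simp only [HMem, map, ← hf.monotone.map_min, ← hf.monotone.map_max, hf.le_iff_le, hf.lt_iff_lt,
    hg.injective.eq_iff]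

theorem vMem_map {f g : ℤ → ℤ} (hf : StrictMono f) (hg : StrictMono g) (P : LShape) (x y : ℤ) :
    (P.map f g).VMem (f x) (g y) ↔ P.VMem x y := by
  simp only [VMem, map, ← hg.monotone.map_min, ← hg.monotone.map_max, hg.le_iff_le, hg.lt_iff_lt,
    hf.injective.eq_iff]

/-- Sharing an edge depends only on the order of the coordinates, so the grid may be stretched
freely. -/
theorem share_map {f g : ℤ → ℤ} (hf : StrictMono f) (hg : StrictMono g) (P Q : LShape) :
    (P.map f g).Share (Q.map f g) ↔ P.Share Q := by
  simp only [share_iff, map, ← hf.monotone.map_min, ← hf.monotone.map_max, hf.lt_iff_lt,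
    ← hg.monotone.map_min, ← hg.monotone.map_max, hg.lt_iff_lt,
    hg.injective.eq_iff, hf.injective.eq_iff]

theorem share_swap (P Q : LShape) : P.swap.Share Q.swap ↔ P.Share Q := by
  simp only [share_iff, swap]; omega

end LShape

open LShape

/-! ### Representations with private edges. -/

/-- The shape of `v` uses a unit edge that no other shape of the family over `S` uses. -/
def HasPrivateEdge {V : Type*} (S : Set V) (P : V → LShape) (v : V) : Prop :=
  (∃ x y, (P v).HMem x y ∧ ∀ u ∈ S, u ≠ v → ¬ (P u).HMem x y) ∨
  ∃ x y, (P v).VMem x y ∧ ∀ u ∈ S, u ≠ v → ¬ (P u).VMem x y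

/-- A representation of the subgraph of `G` induced on `S` by shapes, each with a private edge,
such that the shape of `r` is straight. -/
structure IsLRepresentation {V : Type*} (G : SimpleGraph V) (r : V) (S : Set V) (P : V → LShape) :
    Prop where
  share_iff : ∀ u ∈ S, ∀ v ∈ S, u ≠ v → ((P u).Share (P v) ↔ G.Adj u v)
  hasPrivateEdge : ∀ v ∈ S, HasPrivateEdge S P v
  isStraight : (P r).IsStraight

theorem IsLRepresentation.swap {V : Type*} {G : SimpleGraph V} {r : V} {S : Set V}
    {P : V → LShape} (h : IsLRepresentation G r S P) :
    IsLRepresentation G r S (fun v => (P v).swap) where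
  share_iff u hu v hv huv := by rw [share_swap, h.share_iff u hu v hv huv]
  hasPrivateEdge v hv := by
    rcases h.hasPrivateEdge v hv with ⟨x, y, h1, h2⟩ | ⟨x, y, h1, h2⟩
    · exact Or.inr ⟨y, x, h1, h2⟩
    · exact Or.inl ⟨y, x, h1, h2⟩
  isStraight := h.isStraight.symm

theorem IsLRepresentation.map {V : Type*} {G : SimpleGraph V} {r : V} {S : Set V}
    {P : V → LShape} (h : IsLRepresentation G r S P) {f g : ℤ → ℤ} (hf : StrictMono f)
    (hg : StrictMono g) : IsLRepresentation G r S (fun v => (P v).map f g) where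
  share_iff u hu v hv huv := by rw [share_map hf hg, h.share_iff u hu v hv huv]
  hasPrivateEdge v hv := by
    rcases h.hasPrivateEdge v hv with ⟨x, y, h1, h2⟩ | ⟨x, y, h1, h2⟩
    · exact Or.inl ⟨f x, g y, (hMem_map hf hg _ _ _).2 h1,
        fun u hu huv => (hMem_map hf hg _ _ _).not.2 (h2 u hu huv)⟩
    · exact Or.inr ⟨f x, g y, (vMem_map hf hg _ _ _).2 h1,
        fun u hu huv => (vMem_map hf hg _ _ _).not.2 (h2 u hu huv)⟩
  isStraight := h.isStraight.imp (congrArg f) (congrArg g)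

/-! ### Gadgets for the new vertices of an edge or a cycle. -/

/-- Shapes `Q 0, …, Q (k - 1)` inside a box that represent a path with `k` vertices, such that
exactly the two ends of the path use unit edges of the line `x = 0`. -/
structure IsGadget (k : ℕ) (K : ℤ) (Q : ℕ → LShape) : Prop where
  box : ∀ i < k, -K ≤ (Q i).a ∧ (Q i).a ≤ K ∧ -K ≤ (Q i).a' ∧ (Q i).a' ≤ K ∧
    1 ≤ (Q i).b ∧ (Q i).b ≤ K ∧ 1 ≤ (Q i).b' ∧ (Q i).b' ≤ K
  share_iff : ∀ i < k, ∀ j < k, i < j → ((Q i).Share (Q j) ↔ j = i + 1)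
  line_iff : ∀ i < k, ((Q i).a = 0 ∧ (Q i).b ≠ (Q i).b') ↔ (i = 0 ∨ i + 1 = k)
  hasPrivateEdge : ∀ i < k,
    (∃ x y, (Q i).HMem x y ∧ ∀ j < k, j ≠ i → ¬ (Q j).HMem x y) ∨
    -- The line `x = 0` is excluded because the shape of the attachment vertex runs along it through
    -- the box.
    ∃ x y, x ≠ 0 ∧ (Q i).VMem x y ∧ ∀ j < k, j ≠ i → ¬ (Q j).VMem x y

theorem exists_isGadget_one : ∃ K Q, IsGadget 1 K Q := by
  refine ⟨2, fun _ => ⟨0, 1, 1, 2⟩, ?_, ?_, ?_, ?_⟩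
  · simp
  · omega
  · intro i hi; simp; omega
  · intro i hi
    exact Or.inl ⟨0, 1, by simp [HMem], by omega⟩

/-- For a triangle, both shapes lie on the line `x = 0` and overlap there; their horizontal arms
point to opposite sides and are private. -/
theorem exists_isGadget_two : ∃ K Q, IsGadget 2 K Q := by
  refine ⟨3, fun i => if i = 0 then ⟨0, -1, 1, 3⟩ else ⟨0, 1, 2, 3⟩, ?_, ?_, ?_, ?_⟩
  · intro i hi; interval_cases i <;> simp
  · intro i hi j hj hij; interval_cases i <;> interval_cases j; simp_all [LShape.share_iff]
  · intro i hi; interval_cases i <;> simp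
  · intro i hi
    interval_cases i
    · refine Or.inl ⟨-1, 1, by simp [HMem], ?_⟩
      intro j hj hji; interval_cases j <;> simp_all [HMem]
    · refine Or.inl ⟨0, 2, by simp [HMem], ?_⟩
      intro j hj hji; interval_cases j <;> simp_all [HMem]

/-- The two end shapes leave the line `x = 0` at height 2 in opposite directions. The middle shape
crosses it horizontally, overlaps both arms, and owns its vertical arm. -/
theorem exists_isGadget_three : ∃ K Q, IsGadget 3 K Q := by
  refine ⟨3, fun i => if i = 0 then ⟨0, -3, 2, 3⟩ else if i = 1 then ⟨2, -2, 2, 3⟩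
    else ⟨0, 3, 2, 1⟩, ?_, ?_, ?_, ?_⟩
  · intro i hi; interval_cases i <;> simp
  · intro i hi j hj hij; interval_cases i <;> interval_cases j <;> simp_all [LShape.share_iff]
  · intro i hi; interval_cases i <;> simp
  · intro i hi
    interval_cases i
    · refine Or.inl ⟨-3, 2, by simp [HMem], ?_⟩
      intro j hj hji; interval_cases j <;> simp_all [HMem]
    · refine Or.inr ⟨2, 2, by simp, by simp [VMem], ?_⟩
      intro j hj hji; interval_cases j <;> simp_all [VMem]
    · refine Or.inl ⟨2, 2, by simp [HMem], ?_⟩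
      intro j hj hji; interval_cases j <;> simp_all [HMem]

/-- The shapes `1, …, k - 2` form a chain on the line `x = 3`, where shape `i` occupies heights `2 *
i - 1` to `2 * i + 2`: consecutive intervals overlap in one unit, others are disjoint. The first and
last of the chain turn left and meet the two end shapes in horizontal edges. -/
theorem exists_isGadget_of_four_le {k : ℕ} (hk : 4 ≤ k) : ∃ K Q, IsGadget k K Q := by
  refine ⟨2 * k, fun i =>
    if i = 0 then ⟨0, 2, 1, 2⟩
    else if i = 1 then ⟨3, 1, 1, 4⟩
    else if i + 2 = k then ⟨3, 1, 2 * k - 2, 2 * k - 5⟩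
    else if i + 1 = k then ⟨0, 2, 2 * k - 2, 2 * k - 3⟩
    else ⟨3, 3, 2 * i - 1, 2 * i + 2⟩, ?_, ?_, ?_, ?_⟩
  · intro i hi; split_ifs <;> dsimp only <;> omega
  · intro i hi j hj hij; rw [LShape.share_iff]
    split_ifs <;> dsimp only <;> omega
  · intro i hi; split_ifs <;> dsimp only <;> omega
  · intro i hi
    by_cases h0 : i = 0
    · refine Or.inl ⟨0, 1, ?_, fun j hj hji => ?_⟩ <;> unfold HMem <;> split_ifs <;> dsimp only <;> omega
    by_cases h1 : i = 1
    · refine Or.inl ⟨2, 1, ?_, fun j hj hji => ?_⟩ <;> unfold HMem <;> split_ifs <;> dsimp only <;> omega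
    by_cases h2 : i + 2 = k
    · refine Or.inl ⟨2, 2 * k - 2, ?_, fun j hj hji => ?_⟩ <;> unfold HMem <;>
        split_ifs <;> dsimp only <;> omega
    by_cases h3 : i + 1 = k
    · refine Or.inl ⟨0, 2 * k - 2, ?_, fun j hj hji => ?_⟩ <;> unfold HMem <;>
        split_ifs <;> dsimp only <;> omega
    · refine Or.inr ⟨3, 2 * i, by omega, ?_, fun j hj hji => ?_⟩ <;> unfold VMem <;>
        split_ifs <;> dsimp only <;> omega

theorem exists_isGadget {k : ℕ} (hk : 1 ≤ k) : ∃ K Q, IsGadget k K Q := by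
  rcases (by omega : k = 1 ∨ k = 2 ∨ k = 3 ∨ 4 ≤ k) with rfl | rfl | rfl | h
  · exact exists_isGadget_one
  · exact exists_isGadget_two
  · exact exists_isGadget_three
  · exact exists_isGadget_of_four_le h

/-! ### Attaching an ear. -/

/-- The vertices `w 0, …, w (k - 1)` are attached to `S` at the vertex `v` of `S` as the inner
vertices of a closed walk from `v` to `v` that is a cycle or, if `k = 1`, an edge. -/
structure IsEar {V : Type*} (G : SimpleGraph V) (S : Set V) (v : V) (k : ℕ) (w : ℕ → V) :
    Prop where
  pos : 1 ≤ k
  mem : v ∈ S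
  notMem : ∀ i < k, w i ∉ S
  inj : ∀ i < k, ∀ j < k, w i = w j → i = j
  adj_iff : ∀ i < k, ∀ j < k, i < j → (G.Adj (w i) (w j) ↔ j = i + 1)
  adj_root_iff : ∀ i < k, (G.Adj (w i) v ↔ i = 0 ∨ i + 1 = k)
  not_adj : ∀ i < k, ∀ u ∈ S, u ≠ v → ¬ G.Adj (w i) u

theorem IsLRepresentation.extend_of_vMem {V : Type*} {G : SimpleGraph V} {r : V} {S : Set V}
    {P : V → LShape} (h : IsLRepresentation G r S P) (hr : r ∈ S) {v : V} {k : ℕ} {w : ℕ → V}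
    (hw : IsEar G S v k w) (hv : (P v).VMem 0 0) (hv' : ∀ u ∈ S, u ≠ v → ¬ (P u).VMem 0 0) :
    ∃ P', IsLRepresentation G r (S ∪ w '' Set.Iio k) P' := by
  classical
  obtain ⟨K, Q, hQ⟩ := exists_isGadget hw.pos
  have hK : 1 ≤ K := by have := hQ.box 0 hw.pos; omega
  -- The map `f` clears all vertical lines with `|x| ≤ K` except `x = 0`; the map `g` clears the
  -- heights `1, …, K`, so the unit edge above the origin becomes a segment of length `K + 1`.
  obtain ⟨f, hf⟩ : ∃ f : ℤ → ℤ, f = fun x => if x < 0 then x - K else if x = 0 then 0 else x + K :=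
    ⟨_, rfl⟩
  obtain ⟨g, hg⟩ : ∃ g : ℤ → ℤ, g = fun y => if y ≤ 0 then y else y + K := ⟨_, rfl⟩
  have hfm : StrictMono f := by
    intro x y hxy; simp only [hf]; split_ifs <;> omega
  have hgm : StrictMono g := by
    intro x y hxy; simp only [hg]; split_ifs <;> omega
  have hf0 : ∀ x, f x = 0 ↔ x = 0 := by
    intro x; simp only [hf]; split_ifs <;> omega
  have hfK : ∀ x, -K ≤ f x → f x ≤ K → x = 0 := by
    intro x; simp only [hf]; split_ifs <;> omega
  have hgK : ∀ y, g y ≤ 0 ∧ y ≤ 0 ∨ K + 1 ≤ g y ∧ 1 ≤ y := by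
    intro y; simp only [hg]; split_ifs <;> omega
  have hg0 : g 0 = 0 := by simp [hg]
  have h' := h.map hfm hgm
  -- no shape of the stretched family uses a horizontal edge of the box
  have hH : ∀ u x y, 1 ≤ y → y ≤ K → ¬ ((P u).map f g).HMem x y := by
    intro u x y h1 h2 h3
    have := hgK (P u).b
    simp only [HMem, LShape.map] at h3; omega
  have hVa : ∀ u x y, -K ≤ x → x ≤ K → ((P u).map f g).VMem x y → x = 0 := by
    intro u x y h1 h2 h3
    have := hfK (P u).a
    have := (hf0 (P u).a).2
    simp only [VMem, LShape.map] at h3; omega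
  have hVb : ∀ u y, 1 ≤ y → y ≤ K → (((P u).map f g).VMem 0 y ↔ (P u).VMem 0 0) := by
    intro u y h1 h2
    have h3 := hgK (P u).b
    have h4 := hgK (P u).b'
    have h5 := hf0 (P u).a
    simp only [VMem, LShape.map]
    omega
  have hV : ∀ u ∈ S, ∀ x y, -K ≤ x → x ≤ K → 1 ≤ y → y ≤ K →
      (((P u).map f g).VMem x y ↔ x = 0 ∧ u = v) := by
    intro u hu x y h1 h2 h3 h4
    constructor
    · intro h5
      have h6 := hVa u x y h1 h2 h5
      subst h6
      rw [hVb u y h3 h4] at h5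
      exact ⟨rfl, by_contra fun h7 => hv' u hu h7 h5⟩
    · rintro ⟨rfl, rfl⟩
      exact (hVb u y h3 h4).2 hv
  have hQH : ∀ i < k, ∀ x y, (Q i).HMem x y → 1 ≤ y ∧ y ≤ K := by
    intro i hi x y h1
    have := hQ.box i hi
    simp only [HMem] at h1; omega
  have hQV : ∀ i < k, ∀ x y, (Q i).VMem x y → -K ≤ x ∧ x ≤ K ∧ 1 ≤ y ∧ y ≤ K := by
    intro i hi x y h1
    have := hQ.box i hi
    simp only [VMem] at h1; omega
  have hold : ∀ u ∈ S, ∀ i < k, (((P u).map f g).Share (Q i) ↔ G.Adj u (w i)) := by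
    intro u hu i hi
    have key : ((P u).map f g).Share (Q i) ↔ u = v ∧ (i = 0 ∨ i + 1 = k) := by
      constructor
      · rintro (⟨x, y, h1, h2⟩ | ⟨x, y, h1, h2⟩)
        · exact absurd h1 (hH u x y (hQH i hi x y h2).1 (hQH i hi x y h2).2)
        · obtain ⟨b1, b2, b3, b4⟩ := hQV i hi x y h2
          obtain ⟨hx, huv⟩ := (hV u hu x y b1 b2 b3 b4).1 h1
          refine ⟨huv, (hQ.line_iff i hi).1 ?_⟩
          simp only [VMem] at h2; omega
      · rintro ⟨rfl, h1⟩
        have h2 := (hQ.line_iff i hi).2 h1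
        have h3 : (Q i).VMem 0 (min (Q i).b (Q i).b') := by simp only [VMem]; omega
        obtain ⟨b1, b2, b3, b4⟩ := hQV i hi _ _ h3
        exact Or.inr ⟨_, _, (hV u hu _ _ b1 b2 b3 b4).2 ⟨rfl, rfl⟩, h3⟩
    rw [key]
    constructor
    · rintro ⟨rfl, h1⟩
      exact ((hw.adj_root_iff i hi).2 h1).symm
    · intro h1
      have h2 : u = v := by_contra fun h3 => hw.not_adj i hi u hu h3 h1.symm
      subst h2
      exact ⟨rfl, (hw.adj_root_iff i hi).1 h1.symm⟩
  have hnew : ∀ i < k, ∀ j < k, w i ≠ w j → ((Q i).Share (Q j) ↔ G.Adj (w i) (w j)) := by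
    intro i hi j hj hij
    have hij' : i ≠ j := fun e => hij (e ▸ rfl)
    rcases lt_or_gt_of_ne hij' with h1 | h1
    · rw [hQ.share_iff i hi j hj h1, hw.adj_iff i hi j hj h1]
    · rw [LShape.share_comm, G.adj_comm, hQ.share_iff j hj i hi h1, hw.adj_iff j hj i hi h1]
  obtain ⟨P', hP'⟩ : ∃ P' : V → LShape, P' =
      fun u => if hu : ∃ i < k, u = w i then Q hu.choose else (P u).map f g := ⟨_, rfl⟩
  have hPS : ∀ u ∈ S, P' u = (P u).map f g := by
    intro u hu
    rw [hP']
    exact dif_neg (by rintro ⟨i, hi, rfl⟩; exact hw.notMem i hi hu)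
  have hPw : ∀ i < k, P' (w i) = Q i := by
    intro i hi
    have hex : ∃ j < k, w i = w j := ⟨i, hi, rfl⟩
    rw [hP']
    simp only [dif_pos hex]
    rw [← hw.inj i hi _ hex.choose_spec.1 hex.choose_spec.2]
  refine ⟨P', ⟨?_, ?_, ?_⟩⟩
  · rintro u (hu | ⟨i, hi, rfl⟩) v (hv | ⟨j, hj, rfl⟩) huv
    · rw [hPS u hu, hPS v hv, h'.share_iff u hu v hv huv]
    · rw [hPS u hu, hPw j hj, hold u hu j hj]
    · rw [hPS v hv, hPw i hi, LShape.share_comm, hold v hv i hi, G.adj_comm]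
    · rw [hPw i hi, hPw j hj, hnew i hi j hj huv]
  · rintro u (hu | ⟨i, hi, rfl⟩)
    · by_cases huv : u = v
      · subst huv
        -- The bottom unit edge of the stretched segment stays private, since the gadget begins at
        -- height 1.
        refine Or.inr ⟨0, 0, ?_, ?_⟩
        · rw [hPS u hu]
          simpa [hg0, (hf0 0).2] using (vMem_map hfm hgm (P u) 0 0).2 hv
        · rintro z (hz | ⟨i, hi, rfl⟩) hzu
          · rw [hPS z hz]
            simpa [hg0, (hf0 0).2] using (vMem_map hfm hgm (P z) 0 0).not.2 (hv' z hz hzu)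
          · rw [hPw i hi]
            intro h1
            have := hQV i hi 0 0 h1
            omega
      · rcases h.hasPrivateEdge u hu with ⟨x, y, h1, h2⟩ | ⟨x, y, h1, h2⟩
        · refine Or.inl ⟨f x, g y, ?_, ?_⟩
          · rw [hPS u hu]; exact (hMem_map hfm hgm _ _ _).2 h1
          · rintro z (hz | ⟨i, hi, rfl⟩) hzu
            · rw [hPS z hz]; exact (hMem_map hfm hgm _ _ _).not.2 (h2 z hz hzu)
            · rw [hPw i hi]
              intro h3
              have := hQH i hi _ _ h3
              have := hgK y
              omega
        · refine Or.inr ⟨f x, g y, ?_, ?_⟩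
          · rw [hPS u hu]; exact (vMem_map hfm hgm _ _ _).2 h1
          · rintro z (hz | ⟨i, hi, rfl⟩) hzu
            · rw [hPS z hz]; exact (vMem_map hfm hgm _ _ _).not.2 (h2 z hz hzu)
            · rw [hPw i hi]
              intro h3
              have := hQV i hi _ _ h3
              have := hgK y
              omega
    · rcases hQ.hasPrivateEdge i hi with ⟨x, y, h1, h2⟩ | ⟨x, y, hx, h1, h2⟩
      · refine Or.inl ⟨x, y, by rwa [hPw i hi], ?_⟩
        rintro z (hz | ⟨j, hj, rfl⟩) hzu
        · rw [hPS z hz]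
          exact hH z x y (hQH i hi x y h1).1 (hQH i hi x y h1).2
        · rw [hPw j hj]
          exact h2 j hj fun e => hzu (e ▸ rfl)
      · refine Or.inr ⟨x, y, by rwa [hPw i hi], ?_⟩
        rintro z (hz | ⟨j, hj, rfl⟩) hzu
        · rw [hPS z hz]
          obtain ⟨b1, b2, b3, b4⟩ := hQV i hi x y h1
          exact fun h3 => hx ((hV z hz x y b1 b2 b3 b4).1 h3).1
        · rw [hPw j hj]
          exact h2 j hj fun e => hzu (e ▸ rfl)
  · rw [hPS r hr]
    exact h'.isStraight

theorem IsLRepresentation.extend {V : Type*} {G : SimpleGraph V} {r : V} {S : Set V}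
    {P : V → LShape} (h : IsLRepresentation G r S P) (hr : r ∈ S) {v : V} {k : ℕ} {w : ℕ → V}
    (hw : IsEar G S v k w) : ∃ P', IsLRepresentation G r (S ∪ w '' Set.Iio k) P' := by
  obtain ⟨P, h, x, y, h1, h2⟩ : ∃ P, IsLRepresentation G r S P ∧
      ∃ x y, (P v).VMem x y ∧ ∀ u ∈ S, u ≠ v → ¬ (P u).VMem x y := by
    rcases h.hasPrivateEdge v hw.mem with ⟨x, y, h1, h2⟩ | h1
    · exact ⟨_, h.swap, y, x, h1, h2⟩
    · exact ⟨_, h, h1⟩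
  have hf : StrictMono fun t : ℤ => t - x := fun s t hst => by dsimp only; omega
  have hg : StrictMono fun t : ℤ => t - y := fun s t hst => by dsimp only; omega
  refine (h.map hf hg).extend_of_vMem hr hw ?_ fun u hu huv => ?_
  · simpa using (vMem_map hf hg (P v) x y).2 h1
  · simpa using (vMem_map hf hg (P u) x y).not.2 (h2 u hu huv)

/-! ### From L-shapes to grid paths. -/

theorem SimpleGraph.exists_walk_of_forall_adj {V : Type*} {G : SimpleGraph V} (p : ℕ → V) (n : ℕ)
    (h : ∀ i, G.Adj (p i) (p (i + 1))) :
    ∃ w : G.Walk (p 0) (p n), w.length = n ∧ ∀ i ≤ n, w.getVert i = p i := by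
  induction n generalizing p with
  | zero =>
    refine ⟨.nil, rfl, fun i hi => ?_⟩
    obtain rfl := Nat.le_zero.1 hi
    rfl
  | succ n ih =>
    obtain ⟨w, hl, hw⟩ := ih (fun i => p (i + 1)) fun i => h (i + 1)
    refine ⟨.cons (h 0) w, by simp [hl], fun i hi => ?_⟩
    cases i with
    | zero => rfl
    | succ i => simpa using hw i (by omega)

namespace LShape

/-- The number of unit edges of the horizontal part. -/
def hLength (P : LShape) : ℕ := (P.a - P.a').natAbs

/-- The number of unit edges of the vertical part. -/
def vLength (P : LShape) : ℕ := (P.b' - P.b).natAbs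

/-- The points of the shape, in the order from `(a', b)` over `(a, b)` to `(a, b')`. -/
def point (P : LShape) (i : ℕ) : ℤ × ℤ :=
  (if P.a' ≤ P.a then min (P.a' + i) P.a else max (P.a' - i) P.a,
   if P.b ≤ P.b' then P.b + (i - P.hLength : ℕ) else P.b - (i - P.hLength : ℕ))

/-- No bound on `i` is needed: beyond the end of the shape, `point` continues along the vertical
ray. -/
theorem adj_point (P : LShape) (i : ℕ) : rectGrid.Adj (P.point i) (P.point (i + 1)) := by
  simp only [rectGrid, point, hLength]
  split_ifs <;> grind

theorem point_injective (P : LShape) : P.point.Injective := by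
  intro i j h
  simp only [point, hLength, Prod.mk.injEq] at h
  split_ifs at h <;> omega

theorem exists_gridPath (P : LShape) (hP : 0 < P.hLength + P.vLength) :
    ∃ p : GridPath, p.walk.length = P.hLength + P.vLength ∧
      ∀ i ≤ P.hLength + P.vLength, p.walk.getVert i = P.point i := by
  obtain ⟨w, hl, hw⟩ := SimpleGraph.exists_walk_of_forall_adj P.point _ P.adj_point
  refine ⟨⟨_, _, w, ?_, hl.symm ▸ hP⟩, hl, hw⟩
  rw [← SimpleGraph.Walk.IsPath.getVert_injOn_iff]
  intro i hi j hj hij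
  simp only [Set.mem_ofPred_eq, hl] at hi hj
  rw [hw i hi, hw j hj] at hij
  exact P.point_injective hij

theorem exists_point_iff (P : LShape) (e : Sym2 (ℤ × ℤ)) :
    (∃ i < P.hLength + P.vLength, s(P.point i, P.point (i + 1)) = e) ↔
      (∃ x y, P.HMem x y ∧ e = s((x, y), (x + 1, y))) ∨
      (∃ x y, P.VMem x y ∧ e = s((x, y), (x, y + 1))) := by
  constructor
  · rintro ⟨i, hi, rfl⟩
    simp only [hLength, vLength] at hi
    by_cases h : i < P.hLength
    · refine Or.inl ⟨min (P.point i).1 (P.point (i + 1)).1, P.b, ?_, ?_⟩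
      · simp only [HMem, point, hLength, true_and] at *; split_ifs <;> omega
      · simp only [point, hLength, Sym2.eq_iff, Prod.mk.injEq] at *
        split_ifs <;> omega
    · refine Or.inr ⟨P.a, min (P.point i).2 (P.point (i + 1)).2, ?_, ?_⟩
      · simp only [VMem, point, hLength, true_and] at *; split_ifs <;> omega
      · simp only [point, hLength, Sym2.eq_iff, Prod.mk.injEq] at *
        split_ifs <;> omega
  · rintro (⟨x, y, h, rfl⟩ | ⟨x, y, h, rfl⟩)
    · simp only [HMem] at h
      refine ⟨if P.a' ≤ P.a then (x - P.a').toNat else (P.a' - x - 1).toNat, ?_, ?_⟩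
      · simp only [hLength, vLength]; split_ifs <;> omega
      · simp only [point, hLength, Sym2.eq_iff, Prod.mk.injEq]
        split_ifs <;> omega
    · simp only [VMem] at h
      refine ⟨P.hLength + if P.b ≤ P.b' then (y - P.b).toNat else (P.b - y - 1).toNat, ?_, ?_⟩
      · simp only [hLength, vLength]; split_ifs <;> omega
      · simp only [point, hLength, Sym2.eq_iff, Prod.mk.injEq]
        split_ifs <;> omega

/-- The grid path along a nondegenerate shape. -/
theorem exists_gridPath_edgeSet (P : LShape) (hP : 0 < P.hLength + P.vLength) :
    ∃ p : GridPath, (∀ e, e ∈ p.edgeSet ↔ (∃ x y, P.HMem x y ∧ e = s((x, y), (x + 1, y))) ∨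
      (∃ x y, P.VMem x y ∧ e = s((x, y), (x, y + 1)))) ∧ p.bends ≤ 1 ∧
      (P.IsStraight → p.bends = 0) ∧ (P.a = P.a' → p.IsVertical) := by
  obtain ⟨p, hl, hp⟩ := P.exists_gridPath hP
  -- The only possible turn is at the corner, which has index `P.hLength`.
  have hb : ∀ i ∈ (Finset.Ioo 0 p.walk.length).filter fun i =>
      (p.walk.getVert (i - 1)).1 ≠ (p.walk.getVert (i + 1)).1 ∧
      (p.walk.getVert (i - 1)).2 ≠ (p.walk.getVert (i + 1)).2,
      i = P.hLength ∧ ¬ P.IsStraight := by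
    intro i hi
    rw [Finset.mem_filter, Finset.mem_Ioo, hl] at hi
    obtain ⟨⟨h1, h2⟩, h3, h4⟩ := hi
    rw [hp _ (by omega), hp _ (by omega)] at h3 h4
    simp only [point, hLength, vLength, IsStraight] at *
    split_ifs at h3 h4 <;> omega
  refine ⟨p, fun e => ?_, ?_, fun hs => ?_, fun ha q hq => ?_⟩
  · rw [← exists_point_iff]
    induction e with | _ x y
    simp only [GridPath.edgeSet, Set.mem_ofPred_eq, SimpleGraph.Walk.mk_mem_edges_iff_exists, hl]
    refine exists_congr fun i => and_congr_right fun hi => ?_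
    rw [hp i (by omega), hp (i + 1) (by omega)]
  · exact Finset.card_le_one.2 fun i hi j hj => (hb i hi).1.trans (hb j hj).1.symm
  · exact Finset.card_eq_zero.2 (Finset.eq_empty_of_forall_notMem fun i hi => (hb i hi).2 hs)
  · obtain ⟨i, rfl, hi⟩ := SimpleGraph.Walk.mem_support_iff_exists_getVert.1 hq
    have h0 : p.source = P.point 0 := by rw [← hp 0 (by omega), p.walk.getVert_zero]
    rw [hp i (hl ▸ hi), h0]
    simp only [point]
    split_ifs <;> omega

end LShape

theorem IsLRepresentation.exists_isBEPGRepresentation {V : Type*} {G : SimpleGraph V} {r : V}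
    {P : V → LShape} (h : IsLRepresentation G r Set.univ P) :
    ∃ p : V → GridPath, IsBEPGRepresentation 1 G p ∧ (p r).IsVertical ∧ (p r).bends = 0 := by
  -- A straight shape may be horizontal; exchanging the coordinates of the whole family makes it
  -- vertical.
  wlog ha : (P r).a = (P r).a' generalizing P
  · exact this h.swap (h.isStraight.resolve_left ha)
  have hpos : ∀ v, 0 < (P v).hLength + (P v).vLength := by
    intro v
    rcases h.hasPrivateEdge v trivial with ⟨x, y, h1, -⟩ | ⟨x, y, h1, -⟩ <;>
      simp only [HMem, VMem] at h1 <;> unfold hLength vLength <;> omega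
  choose p hE hb hs hv using fun v => (P v).exists_gridPath_edgeSet (hpos v)
  refine ⟨p, ⟨?_, hb⟩, hv r ha, hs r h.isStraight⟩
  ext u v
  constructor
  · rintro ⟨huv, e, h1, h2⟩
    refine (h.share_iff u trivial v trivial huv).1 ?_
    rw [hE] at h1 h2
    rcases h1 with ⟨x, y, h1, rfl⟩ | ⟨x, y, h1, rfl⟩ <;>
      rcases h2 with ⟨x', y', h2, h3⟩ | ⟨x', y', h2, h3⟩ <;>
      rw [Sym2.eq_iff] at h3 <;> simp only [Prod.mk.injEq] at h3
    · obtain ⟨rfl, rfl⟩ : x = x' ∧ y = y' := by omega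
      exact Or.inl ⟨_, _, h1, h2⟩
    · omega
    · omega
    · obtain ⟨rfl, rfl⟩ : x = x' ∧ y = y' := by omega
      exact Or.inr ⟨_, _, h1, h2⟩
  · intro huv
    refine ⟨huv.ne, ?_⟩
    rcases (h.share_iff u trivial v trivial huv.ne).2 huv with ⟨x, y, h1, h2⟩ | ⟨x, y, h1, h2⟩
    · exact ⟨_, (hE u _).2 (Or.inl ⟨x, y, h1, rfl⟩), (hE v _).2 (Or.inl ⟨x, y, h2, rfl⟩)⟩
    · exact ⟨_, (hE u _).2 (Or.inr ⟨x, y, h1, rfl⟩), (hE v _).2 (Or.inr ⟨x, y, h2, rfl⟩)⟩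

/-! ### Leaf blocks of cactus graphs -/

/-- Apply the hypothesis to the set of vertices not reachable from `z`. -/
theorem SimpleGraph.preconnected_of_exists_adj {W : Type*} {H : SimpleGraph W} (z : W)
    (h : ∀ D : Set W, D.Nonempty → z ∉ D → ∃ x ∈ D, ∃ y ∉ D, H.Adj x y) : H.Preconnected := by
  have key : ∀ x, H.Reachable z x := by
    by_contra! hx
    obtain ⟨x, hx, y, hy, hxy⟩ := h {x | ¬ H.Reachable z x} hx fun h => h (.refl z)
    exact hx ((not_not.1 hy).trans hxy.symm.reachable)
  exact fun x y => (key x).symm.trans (key y)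

theorem SimpleGraph.Preconnected.exists_adj {W : Type*} {H : SimpleGraph W} (h : H.Preconnected)
    {D : Set W} {x y : W} (hx : x ∈ D) (hy : y ∉ D) : ∃ p ∈ D, ∃ q ∉ D, H.Adj p q := by
  obtain ⟨w⟩ := h x y
  obtain ⟨d, -, h1, h2⟩ := w.exists_boundary_dart D hx hy
  exact ⟨_, h1, _, h2, d.adj⟩

/-- The subgraph of `G` induced on `A` is preconnected, given a point `z` of `A` that every
nonempty subset of `A` avoiding `z` can be left from. -/
theorem SimpleGraph.Subgraph.preconnected_induce_coe {V : Type*} {G : SimpleGraph V} {A : Set V}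
    {z : V} (hz : z ∈ A)
    (h : ∀ D ⊆ A, D.Nonempty → z ∉ D → ∃ x ∈ D, ∃ y ∈ A, y ∉ D ∧ G.Adj x y) :
    ((⊤ : G.Subgraph).induce A).coe.Preconnected := by
  refine preconnected_of_exists_adj ⟨z, hz⟩ fun D hD hzD => ?_
  obtain ⟨-, ⟨x, hx, rfl⟩, y, hy, hyD, hxy⟩ := h (Subtype.val '' D)
    (by rintro - ⟨x, -, rfl⟩; exact x.2)
    (hD.image _) (by rintro ⟨x, hx, rfl⟩; exact hzD hx)
  exact ⟨x, hx, ⟨y, hy⟩, fun h => hyD ⟨_, h, rfl⟩, by simpa using ⟨x.2, hy, hxy⟩⟩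

theorem not_isCutVertex_induce_coe {V : Type*} {G : SimpleGraph V} {A : Set V} {w z : V}
    (hw : w ∈ A) (hz : z ∈ A) (hzw : z ≠ w)
    (h : ∀ D ⊆ A, D.Nonempty → z ∉ D → w ∉ D →
      ∃ x ∈ D, ∃ y ∈ A, y ∉ D ∧ y ≠ w ∧ G.Adj x y) :
    ¬ IsCutVertex ((⊤ : G.Subgraph).induce A).coe ⟨w, hw⟩ := by
  refine not_not.2 (SimpleGraph.preconnected_of_exists_adj ⟨⟨z, hz⟩, fun h => hzw ?_⟩
    fun D hD hzD => ?_)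
  · exact congrArg Subtype.val h
  obtain ⟨-, ⟨x, hx, rfl⟩, y, hy, hyD, hyw, hxy⟩ := h ((fun x => x.1.1) '' D)
    (by rintro - ⟨x, -, rfl⟩; exact x.1.2) (hD.image _)
    (by rintro ⟨x, hx, rfl⟩; exact hzD hx)
    (by rintro ⟨x, hx, hxw⟩; exact x.2 (Subtype.ext hxw))
  exact ⟨x, hx, ⟨⟨y, hy⟩, fun h => hyw (congrArg Subtype.val h)⟩, fun h => hyD ⟨_, h, rfl⟩,
    by simpa using ⟨x.1.2, hy, hxy⟩⟩

/-- In a biconnected subgraph, one can leave a set of vertices without passing through `v`. -/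
theorem IsBiconnected.exists_adj {V : Type*} {G : SimpleGraph V} {H : G.Subgraph}
    (hH : IsBiconnected H.coe) {D : Set V} {v x y : V} (hxH : x ∈ H.verts) (hx : x ∈ D)
    (hyH : y ∈ H.verts) (hy : y ∉ D) (hxv : x ≠ v) (hyv : y ≠ v) :
    ∃ p ∈ D, ∃ q ∉ D, p ∈ H.verts ∧ q ∈ H.verts ∧ p ≠ v ∧ q ≠ v ∧ H.Adj p q := by
  by_cases hv : v ∈ H.verts
  · obtain ⟨p, hp, q, hq, hpq⟩ := (not_not.1 (hH.2.2 ⟨v, hv⟩)).exists_adj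
      (D := {z | z.1.1 ∈ D}) (x := ⟨⟨x, hxH⟩, fun h => hxv (congrArg Subtype.val h)⟩)
      (y := ⟨⟨y, hyH⟩, fun h => hyv (congrArg Subtype.val h)⟩) hx hy
    exact ⟨p.1, hp, q.1, hq, p.1.2, q.1.2, fun h => p.2 (Subtype.ext h),
      fun h => q.2 (Subtype.ext h), hpq⟩
  · obtain ⟨p, hp, q, hq, hpq⟩ := hH.2.1.preconnected.exists_adj
      (D := {z | z.1 ∈ D}) (x := ⟨x, hxH⟩) (y := ⟨y, hyH⟩) hx hy
    exact ⟨p, hp, q, hq, p.2, q.2, fun h => hv (h ▸ p.2), fun h => hv (h ▸ q.2), hpq⟩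

/-- The set `S` contains `r`, induces a connected subgraph, and contains every biconnected
subgraph of which it contains two vertices. -/
structure IsBlockClosed {V : Type*} (G : SimpleGraph V) (r : V) (S : Set V) : Prop where
  root_mem : r ∈ S
  exists_adj : ∀ D ⊆ S, D.Nonempty → r ∉ D → ∃ x ∈ D, ∃ y ∈ S, y ∉ D ∧ G.Adj x y
  verts_subset : ∀ H : G.Subgraph, IsBiconnected H.coe → ∀ x ∈ S, ∀ y ∈ S, x ≠ y →
    x ∈ H.verts → y ∈ H.verts → H.verts ⊆ S

theorem isBlockClosed_univ {V : Type*} {G : SimpleGraph V} (hG : G.Connected) (r : V) :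
    IsBlockClosed G r Set.univ where
  root_mem := trivial
  exists_adj D _ hD hr := by
    obtain ⟨x, hx⟩ := hD
    obtain ⟨p, hp, q, hq, h⟩ := hG.preconnected.exists_adj hx hr
    exact ⟨p, hp, q, trivial, hq, h⟩
  verts_subset H _ _ _ _ _ _ _ _ := H.verts.subset_univ

/-- The nonempty set `C` of vertices of `S` avoids `r` and is separated from the rest of `S` by
the vertex `v`. -/
structure IsBranch {V : Type*} (G : SimpleGraph V) (r : V) (S : Set V) (v : V) (C : Set V) :
    Prop where
  subset : C ⊆ S
  nonempty : C.Nonempty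
  root_notMem : r ∉ C
  mem : v ∈ S
  notMem : v ∉ C
  adj : ∀ x ∈ C, ∀ y ∈ S, G.Adj x y → y ∈ C ∨ y = v

theorem exists_minimal_isBranch {V : Type*} [Finite V] {G : SimpleGraph V} {r : V} {S : Set V}
    (hr : r ∈ S) (hS : S ≠ {r}) : ∃ v C, IsBranch G r S v C ∧
      ∀ v' C', IsBranch G r S v' C' → C' ⊆ C → C' = C := by
  have hne : {C | ∃ v, IsBranch G r S v C}.Nonempty := by
    obtain ⟨x, hx, hxr⟩ : ∃ x ∈ S, x ≠ r := by
      by_contra! h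
      exact hS (Set.eq_singleton_iff_unique_mem.2 ⟨hr, h⟩)
    -- Everything except the root is a branch, separated by the root itself.
    exact ⟨S \ {r}, r, Set.sdiff_subset, ⟨x, hx, hxr⟩, fun h => h.2 rfl, hr, fun h => h.2 rfl,
      fun x hx y hy _ => or_iff_not_imp_right.2 fun h => ⟨hy, h⟩⟩
  obtain ⟨C, hC⟩ := (Set.toFinite _).exists_minimal hne
  obtain ⟨v, hv⟩ := hC.1
  exact ⟨v, C, hv, fun v' C' h' hle => hC.eq_of_le ⟨v', h'⟩ hle⟩

/-- Leaving `C` inside `S` requires passing through `v`, but a biconnected subgraph stays connected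
without `v`. -/
theorem IsBranch.verts_subset {V : Type*} {G : SimpleGraph V} {r v : V} {S C : Set V}
    (hC : IsBranch G r S v C) {H : G.Subgraph} (hH : IsBiconnected H.coe) (hHS : H.verts ⊆ S)
    {x : V} (hxH : x ∈ H.verts) (hx : x ∈ C) : H.verts ⊆ insert v C := by
  intro y hy
  by_contra hyC
  rw [Set.mem_insert_iff, not_or] at hyC
  obtain ⟨p, hp, q, hq, -, hqH, -, hqv, hpq⟩ := hH.exists_adj hxH hx hy hyC.2
    (by rintro rfl; exact hC.notMem hx) hyC.1
  exact (hC.adj p hp q (hHS hqH) hpq.adj_sub).elim hq hqv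

/-- If deleting `w` disconnected the induced subgraph, a part not containing a chosen base point
would be a strictly smaller branch, separated by `w`. Maximality follows from the closure of `S`
under biconnected subgraphs and from `IsBranch.verts_subset`. -/
theorem IsBranch.isBlock {V : Type*} {G : SimpleGraph V} {r v : V} {S C : Set V}
    (hS : IsBlockClosed G r S) (hC : IsBranch G r S v C)
    (hmin : ∀ v' C', IsBranch G r S v' C' → C' ⊆ C → C' = C) :
    IsBlock ((⊤ : G.Subgraph).induce (insert v C)) := by
  have hvC := hC.notMem
  obtain ⟨x₀, hx₀⟩ := hC.nonempty
  have hx₀v : x₀ ≠ v := fun h => hvC (h ▸ hx₀)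
  have hsub : ∀ {D : Set V}, D ⊆ insert v C → v ∉ D → D ⊆ C := fun h hv x hx =>
    (h hx).resolve_left fun e => hv (e ▸ hx)
  refine ⟨⟨⟨⟨⟨v, .inl rfl⟩, ⟨x₀, .inr hx₀⟩, fun h => hx₀v (congrArg Subtype.val h).symm⟩⟩,
    ?_, ?_⟩, ?_⟩
  · have : Nonempty ((⊤ : G.Subgraph).induce (insert v C)).verts := ⟨⟨v, .inl rfl⟩⟩
    refine ⟨SimpleGraph.Subgraph.preconnected_induce_coe (Set.mem_insert v C) ?_⟩
    intro D hD hDne hvD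
    have hDC := hsub hD hvD
    obtain ⟨x, hx, y, hy, hyD, hxy⟩ := hS.exists_adj D (hDC.trans hC.subset) hDne
      fun h => hC.root_notMem (hDC h)
    exact ⟨x, hx, y, (hC.adj x (hDC hx) y hy hxy).symm, hyD, hxy⟩
  · rintro ⟨w, hw⟩
    by_cases hwv : w = v
    · subst hwv
      refine not_isCutVertex_induce_coe hw (.inr hx₀) hx₀v fun D hD hDne hxD hwD => ?_
      by_contra! hcon
      have hDC := hsub hD hwD
      have : D = C := hmin w D ⟨hDC.trans hC.subset, hDne, fun h => hC.root_notMem (hDC h), hC.mem,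
        hwD, fun x hx y hy hxy => by
          by_contra! hyD
          exact hcon x hx y (hC.adj x (hDC hx) y hy hxy).symm hyD.1 hyD.2 hxy⟩ hDC
      exact hxD (this ▸ hx₀)
    · have hwC : w ∈ C := hw.resolve_left hwv
      refine not_isCutVertex_induce_coe hw (.inl rfl) (Ne.symm hwv) fun D hD hDne hvD hwD => ?_
      by_contra! hcon
      have hDC := hsub hD hvD
      have : D = C := hmin w D ⟨hDC.trans hC.subset, hDne, fun h => hC.root_notMem (hDC h),
        hC.subset hwC, hwD, fun x hx y hy hxy => by
          by_contra! hyD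
          exact hcon x hx y (hC.adj x (hDC hx) y hy hxy).symm hyD.1 hyD.2 hxy⟩ hDC
      exact hwD (this ▸ hwC)
  · intro H hH hle
    have hvH : v ∈ H.verts := hle.1 (.inl rfl)
    have hxH : x₀ ∈ H.verts := hle.1 (.inr hx₀)
    have hHS := hS.verts_subset H hH v hC.mem x₀ (hC.subset hx₀) hx₀v.symm hvH hxH
    have hHC := hC.verts_subset hH hHS hxH hx₀
    refine ⟨hHC, fun a b hab => ?_⟩
    simpa using ⟨hHC (H.edge_vert hab), hHC (H.edge_vert hab.symm), hab.adj_sub⟩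

theorem IsBranch.isBlockClosed_diff {V : Type*} {G : SimpleGraph V} {r v : V} {S C : Set V}
    (hS : IsBlockClosed G r S) (hC : IsBranch G r S v C) : IsBlockClosed G r (S \ C) where
  root_mem := ⟨hS.root_mem, hC.root_notMem⟩
  exists_adj D hD hDne hrD := by
    by_cases hvD : v ∈ D
    -- Adding `C` to `D` rules out exits into `C`; an exit from `C` could only lead to `v`, which
    -- already lies in `D`.
    · obtain ⟨x, hx, y, hy, hyD, hxy⟩ := hS.exists_adj (D ∪ C)
        (Set.union_subset (hD.trans Set.sdiff_subset) hC.subset) hDne.inl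
        (fun h => h.elim hrD hC.root_notMem)
      rw [Set.mem_union, not_or] at hyD
      rcases hx with hx | hx
      · exact ⟨x, hx, y, ⟨hy, hyD.2⟩, hyD.1, hxy⟩
      · rcases hC.adj x hx y hy hxy with h | rfl
        · exact absurd h hyD.2
        · exact absurd hvD hyD.1
    · obtain ⟨x, hx, y, hy, hyD, hxy⟩ := hS.exists_adj D (hD.trans Set.sdiff_subset) hDne hrD
      refine ⟨x, hx, y, ⟨hy, fun hyC => ?_⟩, hyD, hxy⟩
      rcases hC.adj y hyC x (hD hx).1 hxy.symm with h | rfl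
      · exact (hD hx).2 h
      · exact hvD hx
  verts_subset H hH x hx y hy hxy hxH hyH := by
    have hHS := hS.verts_subset H hH x hx.1 y hy.1 hxy hxH hyH
    refine fun z hz => ⟨hHS hz, fun hzC => ?_⟩
    have h := hC.verts_subset hH hHS hz hzC
    exact hxy (((h hxH).resolve_right hx.2).trans ((h hyH).resolve_right hy.2).symm)

/-- A cycle through `v` has its other vertices as an ear. -/
theorem IsBranch.exists_isEar_of_isCycle {V : Type*} {G : SimpleGraph V} {r v : V} {S C : Set V}
    (hC : IsBranch G r S v C) (c : G.Walk v v) (hc : c.IsCycle)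
    (hB : (⊤ : G.Subgraph).induce (insert v C) = c.toSubgraph) :
    ∃ k w, IsEar G (S \ C) v k w ∧ C = w '' Set.Iio k := by
  have hlen := hc.three_le_length
  have hinj : ∀ i < c.length, ∀ j < c.length, c.getVert i = c.getVert j → i = j :=
    fun i hi j hj h => hc.getVert_injOn' (by simp only [Set.mem_ofPred_eq]; omega)
      (by simp only [Set.mem_ofPred_eq]; omega) h
  have h0 : c.getVert 0 = v := c.getVert_zero
  have hl : c.getVert c.length = v := c.getVert_length
  have hverts : ∀ x, x ∈ insert v C ↔ ∃ i < c.length, c.getVert i = x := by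
    intro x
    have h1 : x ∈ insert v C ↔ x ∈ c.support := by
      rw [← c.mem_verts_toSubgraph, ← hB]; rfl
    rw [h1, SimpleGraph.Walk.mem_support_iff_exists_getVert]
    constructor
    · rintro ⟨i, rfl, hi⟩
      rcases hi.lt_or_eq with h | rfl
      · exact ⟨i, h, rfl⟩
      · exact ⟨0, by omega, by rw [h0, hl]⟩
    · rintro ⟨i, hi, rfl⟩
      exact ⟨i, rfl, hi.le⟩
  have hmemC : ∀ i, i + 1 < c.length → c.getVert (i + 1) ∈ C := by
    intro i hi
    refine ((hverts _).2 ⟨i + 1, hi, rfl⟩).resolve_left fun h => ?_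
    have := hinj (i + 1) hi 0 (by omega) (h.trans h0.symm)
    omega
  -- The cycle has no chords because the block is an induced subgraph.
  have hadj : ∀ i < c.length, ∀ j < c.length, i < j →
      (G.Adj (c.getVert i) (c.getVert j) ↔ j = i + 1 ∨ (i = 0 ∧ j + 1 = c.length)) := by
    intro i hi j hj hij
    have h1 : G.Adj (c.getVert i) (c.getVert j) ↔
        c.toSubgraph.Adj (c.getVert i) (c.getVert j) := by
      rw [← hB]
      exact ⟨fun h => ⟨(hverts _).2 ⟨i, hi, rfl⟩, (hverts _).2 ⟨j, hj, rfl⟩, h⟩, fun h => h.2.2⟩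
    rw [h1, SimpleGraph.Walk.toSubgraph_adj_iff]
    constructor
    · rintro ⟨m, hm, hml⟩
      rw [Sym2.eq_iff] at hm
      -- The closing edge ends at index `c.length`, outside the range of injectivity; there it is
      -- replaced by index `0`.
      by_cases hm1 : m + 1 = c.length
      · rw [hm1, hl.trans h0.symm] at hm
        rcases hm with ⟨h2, h3⟩ | ⟨h2, h3⟩
        · have := hinj _ (by omega) _ hj h3; omega
        · have := hinj _ (by omega) _ hi h3
          have := hinj _ hml _ hj h2; omega
      · rcases hm with ⟨h2, h3⟩ | ⟨h2, h3⟩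
        · have := hinj _ (by omega) _ hj h3
          have := hinj _ hml _ hi h2; omega
        · have := hinj _ (by omega) _ hi h3
          have := hinj _ hml _ hj h2; omega
    · rintro (rfl | ⟨rfl, h2⟩)
      · exact ⟨i, rfl, hi⟩
      · exact ⟨j, by rw [h2, hl, h0, Sym2.eq_swap], hj⟩
  refine ⟨c.length - 1, fun i => c.getVert (i + 1), ⟨by omega, ⟨hC.mem, hC.notMem⟩, ?_, ?_, ?_, ?_,
    ?_⟩, ?_⟩
  · exact fun i hi h => h.2 (hmemC i (by omega))
  · intro i hi j hj h
    have := hinj _ (by omega) _ (by omega) h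
    omega
  · intro i hi j hj hij
    rw [hadj _ (by omega) _ (by omega) (by omega)]
    omega
  · intro i hi
    have := hadj 0 (by omega) (i + 1) (by omega) (by omega)
    rw [h0] at this
    rw [G.adj_comm, this]
    omega
  · intro i hi u hu huv h
    exact (hC.adj _ (hmemC i (by omega)) u hu.1 h).elim hu.2 huv
  · ext x
    constructor
    · intro hx
      obtain ⟨i, hi, rfl⟩ := (hverts x).1 (.inr hx)
      cases i with
      | zero => exact absurd (h0 ▸ hx) hC.notMem
      | succ i => exact ⟨i, by simp only [Set.mem_Iio]; omega, rfl⟩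
    · rintro ⟨i, hi, rfl⟩
      exact hmemC i (by simp only [Set.mem_Iio] at hi; omega)

theorem IsBranch.exists_isEar_of_edge {V : Type*} {G : SimpleGraph V} {r v : V} {S C : Set V}
    (hC : IsBranch G r S v C) {a b : V} (hab : G.Adj a b)
    (hB : (⊤ : G.Subgraph).induce (insert v C) = G.subgraphOfAdj hab) :
    ∃ k w, IsEar G (S \ C) v k w ∧ C = w '' Set.Iio k := by
  have hverts : insert v C = {a, b} := congrArg SimpleGraph.Subgraph.verts hB
  obtain ⟨x, hvx, hx⟩ : ∃ x, G.Adj v x ∧ insert v C = {v, x} := by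
    rcases (hverts ▸ Set.mem_insert v C : v ∈ ({a, b} : Set V)) with h | h
    · exact ⟨b, h ▸ hab, h ▸ hverts⟩
    · obtain rfl : v = b := h
      exact ⟨a, hab.symm, hverts.trans (Set.pair_comm _ _)⟩
  have hCx : C = {x} := by
    ext y
    constructor
    · intro hy
      exact (hx ▸ Set.mem_insert_of_mem v hy : y ∈ ({v, x} : Set V)).resolve_left
        fun h => hC.notMem (h ▸ hy)
    · rintro rfl
      exact (hx ▸ Set.mem_insert_of_mem v rfl : y ∈ insert v C).resolve_left hvx.ne'
  subst hCx
  refine ⟨1, fun _ => x, ⟨le_rfl, ⟨hC.mem, hC.notMem⟩, ?_, ?_, ?_, ?_, ?_⟩, ?_⟩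
  · exact fun i _ h => h.2 rfl
  · omega
  · omega
  · intro i hi
    exact iff_of_true hvx.symm (by omega)
  · intro i _ u hu huv h
    exact (hC.adj x rfl u hu.1 h).elim hu.2 huv
  · ext y
    simp [eq_comm]

theorem IsBlockClosed.exists_isEar {V : Type*} [Finite V] {G : SimpleGraph V} (hG : IsCactus G)
    {r : V} {S : Set V} (hS : IsBlockClosed G r S) (hSr : S ≠ {r}) :
    ∃ S' v k w, IsBlockClosed G r S' ∧ IsEar G S' v k w ∧ S = S' ∪ w '' Set.Iio k ∧ S' ⊂ S := by
  classical
  obtain ⟨v, C, hC, hmin⟩ := exists_minimal_isBranch (G := G) hS.root_mem hSr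
  obtain ⟨k, w, hw, hCw⟩ : ∃ k w, IsEar G (S \ C) v k w ∧ C = w '' Set.Iio k := by
    rcases hG.2 _ (hC.isBlock hS hmin) with ⟨a, b, hab, hB⟩ | ⟨u, c, hc, hB⟩
    · exact hC.exists_isEar_of_edge hab hB
    · have hv : v ∈ c.support := by
        rw [← c.mem_verts_toSubgraph, ← hB]; exact Set.mem_insert v C
      -- The cycle supplied by the cactus property may start anywhere, so it is rotated to start at
      -- `v`.
      exact hC.exists_isEar_of_isCycle (c.rotate v hv) (hc.rotate hv)
        (by rw [hB, SimpleGraph.Walk.toSubgraph_rotate])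
  refine ⟨S \ C, v, k, w, hC.isBlockClosed_diff hS, hw, ?_, ?_⟩
  · rw [← hCw, Set.sdiff_union_of_subset hC.subset]
  · obtain ⟨x, hx⟩ := hC.nonempty
    exact ⟨Set.sdiff_subset, fun h => (h (hC.subset hx)).2 hx⟩

/-! ### Induction over leaf blocks and the theorem. -/

theorem IsBlockClosed.exists_isLRepresentation {V : Type*} [Finite V] {G : SimpleGraph V}
    (hG : IsCactus G) {r : V} {S : Set V} (hS : IsBlockClosed G r S) :
    ∃ P, IsLRepresentation G r S P := by
  induction S using WellFoundedLT.induction with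
  | ind S ih =>
    by_cases hSr : S = {r}
    · subst hSr
      refine ⟨fun _ => ⟨0, 0, 0, 1⟩, ?_, ?_, .inl rfl⟩
      · rintro u rfl v rfl huv
        exact absurd rfl huv
      · rintro u rfl
        exact .inr ⟨0, 0, by simp [LShape.VMem], fun v hv hvu => absurd hv hvu⟩
    · obtain ⟨S', v, k, w, hS', hw, hSw, hlt⟩ := hS.exists_isEar hG hSr
      obtain ⟨P, hP⟩ := ih S' hlt hS'
      rw [hSw]
      exact hP.extend hS'.root_mem hw

theorem mainTheorem4 {V : Type*} [Finite V] (G : SimpleGraph V) (hG : IsCactus G) :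
    IsBEPG 1 G ∧
    ∀ r : V, IsCutVertex G r →
      ∃ P : V → GridPath, IsBEPGRepresentation 1 G P ∧ (P r).IsVertical ∧ (P r).bends = 0 := by
  have key : ∀ r : V,
      ∃ P : V → GridPath, IsBEPGRepresentation 1 G P ∧ (P r).IsVertical ∧ (P r).bends = 0 :=
    fun r => ((isBlockClosed_univ hG.1 r).exists_isLRepresentation hG).elim
      fun _ hP => hP.exists_isBEPGRepresentation
  obtain ⟨r⟩ := hG.1.nonempty
  obtain ⟨P, hP, -⟩ := key r
  exact ⟨⟨P, hP⟩, fun r _ => key r⟩
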